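/- Let $Z$ be a real random variable (the error of a stochastic computation) with $Z\sim\mathcal N(0,\sigma^2)$, $\sigma>0$ (centred normality hypothesis). Let $n\ge 2$, $p\in(0,1)$ and $\alpha\in(0,1)$. For real $k$, the $k$-th bit of $Z$ is said to be significant with probability $p$ if $\mathbb P(|Z|\le 2^{-k})\ge p$, and the number of significant bits of $Z$ with probability $p$ is the largest $s\in\mathbb R$ such that $\mathbb P(|Z|\le 2^{-s})\ge p$. For real numbers $x_1,\dots,x_n$ write $\hat\mu_x=\frac1n\sum_i x_i$ and $\hat\sigma_x=\sqrt{\frac1{n-1}\sum_i(x_i-\hat\mu_x)^2}$. Let $F$ be the cumulative distribution function of $\mathcal N(0,1)$, and let $\chi^2_{1-\alpha/2}$ be the number that a chi-squared variable with $n-1$ degrees of freedom exceeds with probability $1-\alpha/2$. Put $$\delta_{\mathrm{CNH}}(n,p,\alpha)=\tfrac12\log_2\!\left(\frac{n-1}{\chi^2_{1-\alpha/2}}\right)+\log_2 F^{-1}\!\left(\frac{p+1}2\right),$$ which depends only on $n$, $p$ and $\alpha$, and, for a sample $z=(z_1,\dots,z_n)$ of errors, $\hat s_{\mathrm{CNH}}(z)=-\log_2\hat\sigma_z-\delta_{\mathrm{CNH}}(n,p,\alpha)$.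 Then: 1. The largest such $s$ exists. 2. If $Z_1,\dots,Z_n$ are independent random variables with the same law as $Z$, then $$\mathbb P\bigl(s\ge \hat s_{\mathrm{CNH}}(Z_1,\dots,Z_n)\bigr)\ge 1-\alpha .$$ 3. For all real $x_1,\dots,x_n$ with $\hat\mu_x\ne0$, the estimator computed from the relative errors $z_i=x_i/\hat\mu_x-1$ is the MCA estimator $\hat s_{\mathrm{MCA}}=-\log_2|\hat\sigma_x/\hat\mu_x|$ shifted by $\delta_{\mathrm{CNH}}$, that is, $\hat s_{\mathrm{CNH}}(z)=\hat s_{\mathrm{MCA}}-\delta_{\mathrm{CNH}}(n,p,\alpha)$. (In 3, if $\hat\sigma_x=0$, both sides are read with the same conventional value of $\log_2 0$.) -/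

import Mathlib

open MeasureTheory ProbabilityTheory

namespace StochArith

noncomputable section

/-- The quantile function of a probability measure on `ℝ`: the inverse of its cumulative
distribution function wherever the latter is continuous and strictly increasing. -/
def quantile (μ : Measure ℝ) (u : ℝ) : ℝ := sInf {x : ℝ | u ≤ cdf μ x}

/-- `F⁻¹`, with `F` the cumulative distribution function of the standard normal law. -/
def normalQuantile (u : ℝ) : ℝ := quantile (gaussianReal 0 1) u

/-- The chi-squared law with `k` degrees of freedom: the law of the sum of the squares of `k`
independent standard normal variables. -/
def chiSquared (k : ℕ) : Measure ℝ :=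
  (Measure.pi fun _ : Fin k => gaussianReal 0 1).map fun x => ∑ i, x i ^ 2

/-- The critical value `χ²_β` with `k` degrees of freedom, in the upper-tail convention: a
chi-squared variable exceeds `χ²_β` with probability `β`. -/
def chiSquaredCrit (k : ℕ) (β : ℝ) : ℝ := quantile (chiSquared k) (1 - β)

/-- The empirical average of `n` values. -/
def sampleMean {n : ℕ} (x : Fin n → ℝ) : ℝ := (1 / (n : ℝ)) * ∑ i, x i

/-- The empirical standard deviation of `n` values (normalised by `n - 1`). -/
def sampleStd {n : ℕ} (x : Fin n → ℝ) : ℝ :=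
  Real.sqrt ((1 / ((n : ℝ) - 1)) * ∑ i, (x i - sampleMean x) ^ 2)

/-- The MCA estimator `-log₂ |σ̂ / μ̂|` of the number of significant bits. -/
def sMCA {n : ℕ} (x : Fin n → ℝ) : ℝ := -Real.logb 2 |sampleStd x / sampleMean x|

/-- The `k`-th bit (`k` real) of the error `Z` is significant with probability `p`. -/
def IsSignificant {Ω : Type*} [MeasurableSpace Ω] (P : Measure Ω) (Z : Ω → ℝ) (p k : ℝ) : Prop :=
  p ≤ P.real {ω | |Z ω| ≤ (2 : ℝ) ^ (-k)}

/-- The number of significant bits of `Z` with probability `p`: the largest real `s` such that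
the `s`-th bit is significant with probability `p`. -/
def sSto {Ω : Type*} [MeasurableSpace Ω] (P : Measure Ω) (Z : Ω → ℝ) (p : ℝ) : ℝ :=
  sSup {s : ℝ | IsSignificant P Z p s}

/-- The shift `δ`, a function of the number of samples, the probability and the confidence. -/
def deltaCNH (n : ℕ) (p α : ℝ) : ℝ :=
  (1 / 2) * Real.logb 2 (((n : ℝ) - 1) / chiSquaredCrit (n - 1) (1 - α / 2))
    + Real.logb 2 (normalQuantile ((p + 1) / 2))

/-- The estimator `-log₂ σ̂ - δ`, computed from `n` samples of the error. -/
def sCNH {n : ℕ} (p α : ℝ) (z : Fin n → ℝ) : ℝ :=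
  -Real.logb 2 (sampleStd z) - deltaCNH n p α

end

end StochArith

open Filter Topology

namespace StochArith

section Quantile

variable {μ : Measure ℝ} {u : ℝ}

/-! Put q = F⁻¹((p+1)/2). By symmetry of the normal law, P(|Z| ≤ t) = 2F(t/σ) − 1, so s is
significant exactly when σq ≤ 2^(-s). The significant s fill the closed half-line ending at
−log₂(σq), which is therefore the maximum (`isSignificant_iff`). Comparing logarithms, the estimator
is at most this value as soon as the centred sum of squares of the Zᵢ/σ reaches the critical value
(`sCNH_le_of_chiSquaredCrit_le`). That sum is chi-squared with n − 1 degrees of freedom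
(`map_sum_sq_sub_sampleMean`) and the critical value is its α/2-quantile, so this happens with
probability at least 1 − α/2. The MCA identity is algebra: relative errors have mean zero and
deviation |σ̂/μ̂|. -/

theorem quantile_le_iff (hu0 : 0 < u) (hu1 : u < 1) {x : ℝ} :
    quantile μ u ≤ x ↔ u ≤ cdf μ x := by
  have hbdd : BddBelow {x : ℝ | u ≤ cdf μ x} := by
    obtain ⟨b, hb⟩ := ((tendsto_cdf_atBot μ).eventually (gt_mem_nhds hu0)).exists
    refine ⟨b, fun x hx => ?_⟩
    by_contra! h
    exact absurd (hx.trans (monotone_cdf μ h.le)) (not_le.2 hb)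
  have hne : {x : ℝ | u ≤ cdf μ x}.Nonempty := by
    obtain ⟨b, hb⟩ := ((tendsto_cdf_atTop μ).eventually (lt_mem_nhds hu1)).exists
    exact ⟨b, hb.le⟩
  refine ⟨fun h => ?_, fun h => csInf_le hbdd h⟩
  -- Right-continuity makes the infimum attained: points just right of `x` all have cdf at least
  -- `u`.
  have hright : Tendsto (cdf μ) (𝓝[>] x) (𝓝 (cdf μ x)) :=
    ((cdf μ).right_continuous x).mono_left (nhdsWithin_mono _ Set.Ioi_subset_Ici_self)
  refine ge_of_tendsto hright ?_
  filter_upwards [self_mem_nhdsWithin] with y hy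
  obtain ⟨w, hw, hwy⟩ := exists_lt_of_csInf_lt hne (lt_of_le_of_lt h hy)
  exact le_trans hw (monotone_cdf μ hwy.le)

variable [IsProbabilityMeasure μ]

/-- Exhaust the open half-line by closed ones ending before the quantile, where the cdf is below
`u`. Atoms are allowed, so continuity of the chi-squared law is never needed. -/
theorem measureReal_Iio_quantile_le (hu0 : 0 < u) (hu1 : u < 1) :
    μ.real (Set.Iio (quantile μ u)) ≤ u := by
  have h : Tendsto (fun k : ℕ => μ (Set.Iic (quantile μ u - 1 / ((k : ℝ) + 1)))) atTop
      (𝓝 (μ (⋃ k : ℕ, Set.Iic (quantile μ u - 1 / ((k : ℝ) + 1))))) := by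
    refine tendsto_measure_iUnion_atTop fun i j hij => Set.Iic_subset_Iic.2 ?_
    gcongr
  have hU : (⋃ k : ℕ, Set.Iic (quantile μ u - 1 / ((k : ℝ) + 1))) = Set.Iio (quantile μ u) := by
    ext y
    simp only [Set.mem_iUnion, Set.mem_Iic, Set.mem_Iio]
    constructor
    · rintro ⟨k, hk⟩
      have : 0 < 1 / ((k : ℝ) + 1) := by positivity
      linarith
    · intro hy
      obtain ⟨k, hk⟩ := exists_nat_one_div_lt (sub_pos.2 hy)
      exact ⟨k, by linarith⟩
  rw [hU] at h
  refine ENNReal.toReal_le_of_le_ofReal hu0.le (le_of_tendsto' h fun k => ?_)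
  rw [← ofReal_cdf]
  refine ENNReal.ofReal_le_ofReal (le_of_not_ge fun hk => ?_)
  have := (quantile_le_iff hu0 hu1).2 hk
  have : 0 < 1 / ((k : ℝ) + 1) := by positivity
  linarith

theorem one_sub_le_measureReal_Ici_quantile (hu0 : 0 < u) (hu1 : u < 1) :
    1 - u ≤ μ.real (Set.Ici (quantile μ u)) := by
  have h := probReal_compl_eq_one_sub (μ := μ) (measurableSet_Iio (a := quantile μ u))
  rw [Set.compl_Iio] at h
  rw [h]
  linarith [measureReal_Iio_quantile_le (μ := μ) hu0 hu1]

end Quantile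

section Normal

theorem measureReal_Iic_neg_gaussianReal (t : ℝ) :
    (gaussianReal 0 1).real (Set.Iic (-t)) = 1 - cdf (gaussianReal 0 1) t := by
  have := nullSingletonClass_gaussianReal (μ := 0) (v := 1) one_ne_zero
  have hneg : (gaussianReal 0 1).map (fun x => -x) = gaussianReal 0 1 := by
    simpa using gaussianReal_map_neg (μ := 0) (v := 1)
  have h : (gaussianReal 0 1) (Set.Iic (-t)) = (gaussianReal 0 1) (Set.Ioi t) := by
    conv_lhs => rw [← hneg, Measure.map_apply measurable_neg measurableSet_Iic]
    have : (fun x : ℝ => -x) ⁻¹' Set.Iic (-t) = Set.Ici t := by ext; simp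
    rw [this]
    exact (measure_congr Ioi_ae_eq_Ici).symm
  rw [cdf_eq_real, ← probReal_compl_eq_one_sub measurableSet_Iic, Set.compl_Iic]
  simp [measureReal_def, h]

theorem measureReal_abs_le_gaussianReal {t : ℝ} (ht : 0 ≤ t) :
    (gaussianReal 0 1).real {x | |x| ≤ t} = 2 * cdf (gaussianReal 0 1) t - 1 := by
  have := nullSingletonClass_gaussianReal (μ := 0) (v := 1) one_ne_zero
  have hset : {x : ℝ | |x| ≤ t} = Set.Iic t \ Set.Iio (-t) := by
    ext x
    simp [abs_le, and_comm]
  have hIio : (gaussianReal 0 1).real (Set.Iio (-t)) = 1 - cdf (gaussianReal 0 1) t := by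
    rw [← measureReal_Iic_neg_gaussianReal t]
    exact measureReal_congr Iio_ae_eq_Iic
  rw [hset, measureReal_sdiff _ measurableSet_Iio, hIio, ← cdf_eq_real]
  · ring
  · exact fun x hx => (Set.mem_Iio.1 hx).le.trans (by linarith)

theorem cdf_gaussianReal_zero : cdf (gaussianReal 0 1) 0 = 1 / 2 := by
  have h := measureReal_Iic_neg_gaussianReal 0
  rw [neg_zero, ← cdf_eq_real] at h
  linarith

theorem normalQuantile_pos {u : ℝ} (hu : 1 / 2 < u) (hu1 : u < 1) : 0 < normalQuantile u := by
  refine lt_of_not_ge fun h => ?_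
  have := (quantile_le_iff (by linarith) hu1).1 h
  rw [cdf_gaussianReal_zero] at this
  linarith

end Normal

section SignificantBits

variable {Ω : Type*} [MeasurableSpace Ω] {P : Measure Ω} {Z : Ω → ℝ} {σ : NNReal}

theorem hasLaw_div_std (hσ : 0 < σ) (hZ : HasLaw Z (gaussianReal 0 (σ ^ 2)) P) :
    HasLaw (fun ω => Z ω / σ) (gaussianReal 0 1) P := by
  have h := gaussianReal_div_const hZ (σ : ℝ)
  have hv : NNReal.mk ((σ : ℝ) ^ 2) (sq_nonneg _) = σ ^ 2 := by
    ext
    simp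
  rwa [zero_div, hv, div_self (pow_ne_zero 2 hσ.ne')] at h

variable {p : ℝ}

theorem isSignificant_iff (hp0 : 0 < p) (hp1 : p < 1) (hσ : 0 < σ)
    (hZ : HasLaw Z (gaussianReal 0 (σ ^ 2)) P) (s : ℝ) :
    IsSignificant P Z p s ↔ s ≤ -Real.logb 2 (σ * normalQuantile ((p + 1) / 2)) := by
  have hσ' : (0 : ℝ) < σ := hσ
  have hz : 0 < normalQuantile ((p + 1) / 2) := normalQuantile_pos (by linarith) (by linarith)
  have hset : {ω | |Z ω| ≤ (2 : ℝ) ^ (-s)} = {ω | |Z ω / σ| ≤ (2 : ℝ) ^ (-s) / σ} := by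
    ext ω
    simp only [Set.mem_ofPred_eq, abs_div, abs_of_pos hσ', div_le_div_iff_of_pos_right hσ']
  rw [IsSignificant, hset, (hasLaw_div_std hσ hZ).measureReal_eq
    (p := fun x => |x| ≤ (2 : ℝ) ^ (-s) / σ) (measurableSet_le (by fun_prop) (by fun_prop)),
    measureReal_abs_le_gaussianReal (by positivity), le_neg, Real.logb_le_iff_le_rpow one_lt_two
    (by positivity), ← le_div_iff₀' hσ', normalQuantile,
    quantile_le_iff (by linarith) (by linarith)]
  constructor <;> intro h <;> linarith

theorem setOf_isSignificant (hp0 : 0 < p) (hp1 : p < 1) (hσ : 0 < σ)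
    (hZ : HasLaw Z (gaussianReal 0 (σ ^ 2)) P) :
    {s | IsSignificant P Z p s} =
      Set.Iic (-Real.logb 2 (σ * normalQuantile ((p + 1) / 2))) := by
  ext s
  exact isSignificant_iff hp0 hp1 hσ hZ s

theorem sSto_eq (hp0 : 0 < p) (hp1 : p < 1) (hσ : 0 < σ)
    (hZ : HasLaw Z (gaussianReal 0 (σ ^ 2)) P) :
    sSto P Z p = -Real.logb 2 (σ * normalQuantile ((p + 1) / 2)) := by
  rw [sSto, setOf_isSignificant hp0 hp1 hσ hZ, csSup_Iic]

end SignificantBits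

section ChiSquared

instance (k : ℕ) : IsProbabilityMeasure (chiSquared k) :=
  Measure.isProbabilityMeasure_map (Measurable.aemeasurable (by fun_prop))

/-- A nonpositive sum of squares forces the first coordinate to vanish, a null event. At least one
degree of freedom is needed: `chiSquared 0` is the Dirac mass at 0. -/
theorem cdf_chiSquared_succ_zero (k : ℕ) : cdf (chiSquared (k + 1)) 0 = 0 := by
  have := nullSingletonClass_gaussianReal (μ := 0) (v := 1) one_ne_zero
  rw [cdf_eq_real, chiSquared, measureReal_def,
    Measure.map_apply (by fun_prop) measurableSet_Iic]
  have hsub : (fun x : Fin (k + 1) → ℝ => ∑ i, x i ^ 2) ⁻¹' Set.Iic 0 ⊆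
      Function.eval 0 ⁻¹' {0} := by
    intro x hx
    have h := (Finset.single_le_sum (f := fun i => x i ^ 2) (fun i _ => sq_nonneg _)
      (Finset.mem_univ 0)).trans hx
    simpa using le_antisymm h (sq_nonneg _)
  have hnull : (Measure.pi fun _ : Fin (k + 1) => gaussianReal 0 1)
      (Function.eval 0 ⁻¹' {0}) = 0 := by
    rw [(measurePreserving_eval (fun _ : Fin (k + 1) => gaussianReal 0 1) 0).measure_preimage
      (measurableSet_singleton _).nullMeasurableSet, measure_singleton]
  rw [measure_mono_null hsub hnull, ENNReal.toReal_zero]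

theorem quantile_chiSquared_succ_pos (k : ℕ) {u : ℝ} (hu0 : 0 < u) (hu1 : u < 1) :
    0 < quantile (chiSquared (k + 1)) u := by
  refine lt_of_not_ge fun h => ?_
  have := (quantile_le_iff hu0 hu1).1 h
  rw [cdf_chiSquared_succ_zero] at this
  linarith

theorem sum_sq_sub_sampleMean {n : ℕ} (x : Fin n → ℝ) :
    ∑ i, (x i - sampleMean x) ^ 2 = ∑ i, x i ^ 2 - (∑ i, x i) ^ 2 / n := by
  rcases Nat.eq_zero_or_pos n with rfl | hn
  · simp
  have : (n : ℝ) ≠ 0 := by positivity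
  simp only [sub_sq, Finset.sum_add_distrib, Finset.sum_sub_distrib, ← Finset.sum_mul,
    ← Finset.mul_sum, sampleMean, Finset.sum_const, Finset.card_univ, Fintype.card_fin,
    nsmul_eq_mul]
  field_simp
  ring

/-- Along this first axis lies the component of a sample that centring removes. -/
theorem exists_orthonormalBasis_zero_eq_const (m : ℕ) :
    ∃ b : OrthonormalBasis (Fin (m + 1)) ℝ (EuclideanSpace ℝ (Fin (m + 1))),
      b 0 = WithLp.toLp 2 fun _ => 1 / √((m : ℝ) + 1) := by
  set v : EuclideanSpace ℝ (Fin (m + 1)) := WithLp.toLp 2 fun _ => 1 / √((m : ℝ) + 1)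
  have hv : Orthonormal ℝ (({0} : Set (Fin (m + 1))).domRestrict fun _ => v) := by
    refine ⟨fun i => ?_, fun i j hij => absurd (Subsingleton.elim i j) hij⟩
    have : (0 : ℝ) ≤ (m : ℝ) + 1 := by positivity
    have h1 : ‖v‖ ^ 2 = 1 := by
      rw [EuclideanSpace.real_norm_sq_eq]
      simp [v, Real.sq_sqrt this]
      field_simp
    exact (sq_eq_sq₀ (norm_nonneg v) zero_le_one).1 (by rw [h1, one_pow])
  obtain ⟨b, hb⟩ := hv.exists_orthonormalBasis_extension_of_card_eq (by simp)
  exact ⟨b, hb 0 rfl⟩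

/-- The case of Cochran's theorem behind the sample variance. -/
theorem map_sum_sq_sub_sampleMean (m : ℕ) :
    (Measure.pi fun _ : Fin (m + 1) => gaussianReal 0 1).map
      (fun x => ∑ i, (x i - sampleMean x) ^ 2) = chiSquared m := by
  obtain ⟨b, hb⟩ := exists_orthonormalBasis_zero_eq_const m
  have hmeas : Measurable fun x : Fin (m + 1) → ℝ => ∑ i, (x i - sampleMean x) ^ 2 := by
    unfold sampleMean
    fun_prop
  -- Rotation invariance: standard normal coordinates in the basis `b` again give a standard
  -- Gaussian vector.
  have hrot : Measure.map WithLp.ofLp (Measure.map (fun x : Fin (m + 1) → ℝ => ∑ i, x i • b i)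
      (Measure.pi fun _ : Fin (m + 1) => gaussianReal 0 1)) =
      Measure.pi fun _ : Fin (m + 1) => gaussianReal 0 1 := by
    rw [← stdGaussian_eq_map_pi_orthonormalBasis b, ← map_pi_eq_stdGaussian,
      Measure.map_map (by fun_prop) (by fun_prop)]
    exact Measure.map_id
  -- Parseval gives ∑ vᵢ² = ∑ xᵢ², and the mean term is ⟨b 0, v⟩² = x₀²; subtracting leaves the
  -- other m squares.
  have hcoord (x : Fin (m + 1) → ℝ) :
      ∑ i, ((∑ j, x j • b j) i - sampleMean (∑ j, x j • b j).ofLp) ^ 2 =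
        ∑ i : Fin m, x i.succ ^ 2 := by
    set v := ∑ j, x j • b j with hvdef
    have hm : (0 : ℝ) < (m : ℝ) + 1 := by positivity
    have hnorm : ∑ i, v i ^ 2 = ∑ i, x i ^ 2 := by
      rw [← EuclideanSpace.real_norm_sq_eq, ← b.sum_sq_inner_right v]
      refine Finset.sum_congr rfl fun i _ => ?_
      rw [hvdef, b.orthonormal.inner_right_fintype]
    have hmean : (∑ i, v i) ^ 2 / ((m : ℝ) + 1) = x 0 ^ 2 := by
      have h0 : inner ℝ (b 0) v = x 0 := by rw [hvdef, b.orthonormal.inner_right_fintype]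
      rw [← h0, hb, PiLp.inner_apply]
      simp only [RCLike.inner_apply, conj_trivial, ← Finset.sum_mul, mul_pow, div_pow,
        Real.sq_sqrt hm.le]
      ring
    rw [sum_sq_sub_sampleMean, hnorm]
    push_cast
    rw [hmean, Fin.sum_univ_succ]
    ring
  have htail : MeasurePreserving (fun (x : Fin (m + 1) → ℝ) (i : Fin m) => x i.succ)
      (Measure.pi fun _ => gaussianReal 0 1) (Measure.pi fun _ => gaussianReal 0 1) :=
    measurePreserving_snd.comp
      (measurePreserving_piFinSuccAbove (fun _ : Fin (m + 1) => gaussianReal 0 1) 0)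
  rw [chiSquared, ← htail.map_eq, Measure.map_map (by fun_prop) htail.measurable]
  conv_lhs => rw [← hrot, Measure.map_map hmeas (by fun_prop),
    Measure.map_map (hmeas.comp (by fun_prop)) (by fun_prop)]
  congr 1
  funext x
  exact hcoord x

end ChiSquared

section Estimator

variable {n : ℕ}

theorem sampleMean_div_sub_one {x : Fin n → ℝ} (hx : sampleMean x ≠ 0) :
    sampleMean (fun i => x i / sampleMean x - 1) = 0 := by
  have hn : (n : ℝ) ≠ 0 := by
    rintro h
    simp [sampleMean, h] at hx
  have h : ∑ i, x i = n * sampleMean x := by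
    rw [sampleMean]
    field_simp
  conv_lhs => rw [sampleMean]
  simp only [Finset.sum_sub_distrib, ← Finset.sum_div, h, Finset.sum_const, Finset.card_univ,
    Fintype.card_fin, nsmul_eq_mul]
  field_simp
  simp

theorem sampleStd_div_sub_one {x : Fin n → ℝ} (hx : sampleMean x ≠ 0) :
    sampleStd (fun i => x i / sampleMean x - 1) = |sampleStd x / sampleMean x| := by
  have h (i : Fin n) : (x i / sampleMean x - 1) ^ 2 =
      (x i - sampleMean x) ^ 2 / sampleMean x ^ 2 := by
    field_simp
  rw [sampleStd, sampleMean_div_sub_one hx]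
  simp only [sub_zero, h, ← Finset.sum_div]
  rw [← mul_div_assoc, Real.sqrt_div' _ (sq_nonneg _), Real.sqrt_sq_eq_abs, abs_div, sampleStd,
    abs_of_nonneg (Real.sqrt_nonneg _)]

theorem sampleMean_div (x : Fin n → ℝ) (c : ℝ) :
    sampleMean (fun i => x i / c) = sampleMean x / c := by
  rw [sampleMean, sampleMean, ← Finset.sum_div, mul_div_assoc]

theorem sCNH_le_of_chiSquaredCrit_le (hn : 2 ≤ n) {p α σ : ℝ} (hσ : 0 < σ)
    (hz : 0 < normalQuantile ((p + 1) / 2)) (hχ : 0 < chiSquaredCrit (n - 1) (1 - α / 2))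
    {z : Fin n → ℝ} (h : chiSquaredCrit (n - 1) (1 - α / 2) ≤
      ∑ i, (z i / σ - sampleMean (fun j => z j / σ)) ^ 2) :
    sCNH p α z ≤ -Real.logb 2 (σ * normalQuantile ((p + 1) / 2)) := by
  have hn' : (0 : ℝ) < (n : ℝ) - 1 := by
    have : (2 : ℝ) ≤ n := by exact_mod_cast hn
    linarith
  set χ := chiSquaredCrit (n - 1) (1 - α / 2) with hχdef
  set S := ∑ i, (z i - sampleMean z) ^ 2 with hS
  have hsum : ∑ i, (z i / σ - sampleMean (fun j => z j / σ)) ^ 2 = S / σ ^ 2 := by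
    rw [hS, Finset.sum_div]
    refine Finset.sum_congr rfl fun i _ => ?_
    rw [sampleMean_div, ← sub_div, div_pow]
  rw [hsum, le_div_iff₀ (by positivity)] at h
  -- The lower bound also rules out σ̂ = 0, so no logarithm takes its default value.
  have hSpos : 0 < S := lt_of_lt_of_le (by positivity) h
  have hstd : sampleStd z ^ 2 = S / ((n : ℝ) - 1) := by
    rw [sampleStd, Real.sq_sqrt (by positivity)]
    ring
  have hstd_pos : 0 < sampleStd z := Real.sqrt_pos.2 (by positivity)
  have hmain : σ ^ 2 ≤ sampleStd z ^ 2 * (((n : ℝ) - 1) / χ) := by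
    rw [hstd, div_mul_div_cancel₀ hn'.ne', le_div_iff₀ hχ]
    linarith
  have hlog := Real.logb_le_logb_of_le one_lt_two (by positivity) hmain
  rw [Real.logb_mul (by positivity) (by positivity), Real.logb_pow, Real.logb_pow] at hlog
  rw [sCNH, deltaCNH, ← hχdef, Real.logb_mul hσ.ne' hz.ne']
  push_cast at hlog
  linarith

end Estimator

section Confidence

variable {Ω : Type*} [MeasurableSpace Ω] {Q : Measure Ω}

theorem hasLaw_sum_sq_sub_sampleMean {m : ℕ} {Y : Fin (m + 1) → Ω → ℝ} (hind : iIndepFun Y Q)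
    (hY : ∀ i, HasLaw (Y i) (gaussianReal 0 1) Q) :
    HasLaw (fun ω => ∑ i, (Y i ω - sampleMean fun j => Y j ω) ^ 2) (chiSquared m) Q := by
  have hlaw := hind.hasLaw_pi hY
  have hmeas : Measurable fun x : Fin (m + 1) → ℝ => ∑ i, (x i - sampleMean x) ^ 2 := by
    unfold sampleMean
    fun_prop
  have hsum : HasLaw (fun x : Fin (m + 1) → ℝ => ∑ i, (x i - sampleMean x) ^ 2) (chiSquared m)
      (Measure.pi fun _ => gaussianReal 0 1) :=
    ⟨hmeas.aemeasurable, map_sum_sq_sub_sampleMean m⟩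
  exact hsum.fun_comp hlaw

end Confidence

end StochArith

theorem mainTheorem3
    {Ω Ω' : Type*} [MeasurableSpace Ω] [MeasurableSpace Ω']
    (P : Measure Ω) [IsProbabilityMeasure P] (Q : Measure Ω') [IsProbabilityMeasure Q]
    (n : ℕ) (hn : 2 ≤ n)
    (p α : ℝ) (hp0 : 0 < p) (hp1 : p < 1) (hα0 : 0 < α) (hα1 : α < 1)
    (σ : NNReal) (hσ : 0 < σ)
    (Z : Ω → ℝ) (hZ : HasLaw Z (gaussianReal 0 (σ ^ 2)) P)
    (Zs : Fin n → Ω' → ℝ) (hind : iIndepFun Zs Q) (hid : ∀ i, IdentDistrib (Zs i) Z Q P) :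
    -- the number of significant bits with probability `p` is a genuine maximum
    IsGreatest {s : ℝ | StochArith.IsSignificant P Z p s} (StochArith.sSto P Z p) ∧
    -- with confidence `1 - α`, it is at least `sCNH = -log₂ σ̂ - δ` of the samples
    1 - α ≤ Q.real {ω | StochArith.sCNH p α (fun i => Zs i ω) ≤ StochArith.sSto P Z p} ∧
    -- for errors relative to the empirical average, the bound is the MCA estimator shifted by
    -- `δ`, which is a function of `n`, `p` and `α` only
    (∀ x : Fin n → ℝ, StochArith.sampleMean x ≠ 0 →
      StochArith.sCNH p α (fun i => x i / StochArith.sampleMean x - 1) =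
        StochArith.sMCA x - StochArith.deltaCNH n p α) := by
  open StochArith in
  have hσ' : (0 : ℝ) < σ := hσ
  have hz : 0 < normalQuantile ((p + 1) / 2) := normalQuantile_pos (by linarith) (by linarith)
  refine ⟨?_, ?_, fun x hx => ?_⟩
  · rw [sSto_eq hp0 hp1 hσ hZ, setOf_isSignificant hp0 hp1 hσ hZ]
    exact isGreatest_Iic
  · obtain ⟨m, rfl⟩ : ∃ m, n = m + 1 + 1 := ⟨n - 2, by omega⟩
    have hcrit : chiSquaredCrit (m + 1 + 1 - 1) (1 - α / 2) =
        quantile (chiSquared (m + 1)) (α / 2) := by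
      rw [chiSquaredCrit, sub_sub_cancel, Nat.add_sub_cancel]
    have hlaw (i) : HasLaw (fun ω => Zs i ω / σ) (gaussianReal 0 1) Q :=
      hasLaw_div_std hσ ⟨(hid i).aemeasurable_fst, (hid i).map_eq.trans hZ.map_eq⟩
    have hsum := hasLaw_sum_sq_sub_sampleMean
      (hind.comp (fun _ x => x / (σ : ℝ)) fun _ => by fun_prop) hlaw
    have hconf : 1 - α / 2 ≤
        (chiSquared (m + 1)).real {x | quantile (chiSquared (m + 1)) (α / 2) ≤ x} :=
      one_sub_le_measureReal_Ici_quantile (by linarith) (by linarith)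
    rw [← hsum.measureReal_eq (p := fun x => quantile (chiSquared (m + 1)) (α / 2) ≤ x)
      measurableSet_Ici] at hconf
    -- Only one tail is used, so 1 − α/2 is weakened to 1 − α.
    refine le_trans (by linarith) (hconf.trans (measureReal_mono fun ω hω => ?_))
    rw [Set.mem_ofPred_eq, sSto_eq hp0 hp1 hσ hZ]
    refine sCNH_le_of_chiSquaredCrit_le hn hσ' hz ?_ ?_
    · rw [hcrit]
      exact quantile_chiSquared_succ_pos m (by linarith) (by linarith)
    · rw [hcrit]
      exact hω
  -- Both logarithms have the same argument, so σ̂ = 0 needs no separate case.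
  · rw [sCNH, sMCA, sampleStd_div_sub_one hx]
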